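/- All digraphs are finite, without loops and without multiple arcs (two opposite arcs between a pair of vertices are allowed), and connected, meaning that the underlying undirected graph is connected. The dichromatic number of a digraph $G$ is the least $r$ such that the vertex set of $G$ can be partitioned into $r$ sets each of which induces a subdigraph without directed cycles. Let $\mathcal G_{n,r}$ be the set of connected digraphs of order $n$ with dichromatic number $r$. The Laplacian matrix of $G$ is $L(G)=D^+(G)-A(G)$, where $A(G)$ is the adjacency matrix and $D^+(G)$ the diagonal matrix of outdegrees, and the Laplacian energy of $G$ is $LE(G)=\sum_{i=1}^n\lambda_i^2$, where $\lambda_1,\dots,\lambda_n$ are the complex eigenvalues of $L(G)$ with algebraic multiplicity (this sum is real). An in-tree is an orientation of an undirected tree in which every vertex has outdegree at most one; its root is its unique vertex of outdegree $0$. For a vertex set $S$ of $G$ we say that $G$ is its core $G[S]$ with hanging in-trees if every component $T$ (if any) of $G-S$ is an in-tree and there is exactly one arc between $T$ and $S$, going from the root of $T$ to a vertex of $S$. Theorem. Let $G\in\mathcal G_{n,r}$. (i) Let $r=2$. If $n=2$, then $LE(G)\ge 4$, with equality if and only if $G$ is the directed cycle $C_2$. If $n\ge 3$, then $LE(G)\ge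 n$, with equality if and only if for some $n'\ge 3$ there is a vertex set $S$ of $G$ such that the induced subdigraph $G[S]$ is a directed cycle $C_{n'}$ and $G$ is this core with hanging in-trees. (ii) Let $r\ge 3$. Then $LE(G)\ge n+r^3-r^2-r$, with equality if and only if there is a vertex set $S$ of $G$ such that $G[S]$ is the bidirected complete graph $\overset{\leftrightarrow}{K}_r$ (all ordered pairs of distinct vertices are arcs) and $G$ is this core with hanging in-trees. All these bounds are attained for all $n\ge r\ge 2$, so they are the minimum of $LE$ over $\mathcal G_{n,r}$. -/

import Mathlib

open scoped ComplexOrder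

namespace Digraph

noncomputable section

variable {V : Type*}

/-- The subdigraph of `G` induced by the vertex set `s`. -/
def induce (G : Digraph V) (s : Set V) : Digraph s where
  Adj u v := G.Adj u v

/-- The digraphs `G` and `H` are isomorphic. -/
def IsIsomorphic {W : Type*} (G : Digraph V) (H : Digraph W) : Prop :=
  Nonempty (G.Adj ≃r H.Adj)

/-- The directed cycle `C_l` on the vertices `0, …, l - 1`, with the arcs `i → i + 1` modulo `l`. -/
def directedCycle (l : ℕ) : Digraph (Fin l) where
  Adj i j := finRotate l i = j

/-- The bidirected graph of `H`: every edge is replaced by two opposite arcs. -/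
def bidirected (H : SimpleGraph V) : Digraph V where
  Adj := H.Adj

/-- `G` has no directed cycle: no sequence of `l ≥ 1` distinct vertices `c 0, …, c (l - 1)` such
that `c i → c (i + 1)` is an arc for every `i` modulo `l`. -/
def IsAcyclic (G : Digraph V) : Prop :=
  ∀ (l : ℕ) (c : Fin l → V), 0 < l → Function.Injective c →
    ¬ ∀ i, G.Adj (c i) (c (finRotate l i))

/-- `f` is a colouring all of whose colour classes induce acyclic subdigraphs. -/
def IsAcyclicColoring (G : Digraph V) {r : ℕ} (f : V → Fin r) : Prop :=
  ∀ i, (G.induce (f ⁻¹' {i})).IsAcyclic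

/-- The dichromatic number: the least `r` such that the vertices can be partitioned into `r`
acyclic sets. (Empty colour classes are allowed here; this does not change the minimum.) -/
def dichromaticNumber (G : Digraph V) : ℕ :=
  sInf {r | ∃ f : V → Fin r, G.IsAcyclicColoring f}

/-- The number of arcs with tail `v`. -/
def outdegree (G : Digraph V) (v : V) : ℕ :=
  {w | G.Adj v w}.ncard

open Classical in
/-- The 0-1 adjacency matrix. -/
def adjMatrix (G : Digraph V) : Matrix V V ℂ :=
  Matrix.of fun u v => if G.Adj u v then 1 else 0

/-- The Laplacian matrix: the diagonal matrix of the outdegrees minus the adjacency matrix. -/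
def lapMatrix [DecidableEq V] (G : Digraph V) : Matrix V V ℂ :=
  Matrix.diagonal (fun v => (G.outdegree v : ℂ)) - G.adjMatrix

/-- The `k`-th Laplacian spectral moment: the sum of the `k`-th powers of the complex eigenvalues of
the Laplacian matrix, taken with their algebraic multiplicities. -/
def laplacianMoment [Fintype V] [DecidableEq V] (k : ℕ) (G : Digraph V) : ℂ :=
  (G.lapMatrix.charpoly.roots.map fun z => z ^ k).sum

/-- The Laplacian energy. It is a sum of squares of complex numbers; inequalities
`(a : ℂ) ≤ G.laplacianEnergy` with `a` real refer to the partial order of `ℂ` and include the claim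
that the energy is a real number. -/
def laplacianEnergy [Fintype V] [DecidableEq V] (G : Digraph V) : ℂ :=
  G.laplacianMoment 2

/-- The connected digraphs without loops on the vertex type `V` that have dichromatic number `r`.
Connectedness refers to the underlying undirected graph. -/
def withDichromaticNumber (V : Type*) (r : ℕ) : Set (Digraph V) :=
  {G | (∀ v, ¬ G.Adj v v) ∧ G.toSimpleGraphInclusive.Connected ∧ G.dichromaticNumber = r}

/-- A directed tree: an undirected tree each of whose edges is given one direction. -/
def IsDirectedTree (T : Digraph V) : Prop :=
  T.toSimpleGraphInclusive.IsTree ∧ ∀ u v, T.Adj u v → ¬ T.Adj v u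

/-- An in-tree: a directed tree in which every outdegree is at most one. -/
def IsInTree (T : Digraph V) : Prop :=
  T.IsDirectedTree ∧ ∀ v, T.outdegree v ≤ 1

/-- The root of an in-tree: the vertex of outdegree zero. -/
def IsRoot (T : Digraph V) (v : V) : Prop :=
  T.outdegree v = 0

/-- The connected components of the digraph `G`, that is, of its underlying undirected graph. -/
abbrev Component (G : Digraph V) : Type _ :=
  G.toSimpleGraphInclusive.ConnectedComponent

/-- `G` consists of its subdigraph induced by the core `S` and of in-trees that hang off it:
every component `T` of `G - S` is an in-tree, and the only arc between `T` and `S` is one arc from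
the root of `T` to a vertex of `S`. -/
def HasHangingInTrees (G : Digraph V) (S : Set V) : Prop :=
  ∀ C : (G.induce Sᶜ).Component,
    ((G.induce Sᶜ).induce C.supp).IsInTree ∧
    ∀ v : C.supp,
      (((G.induce Sᶜ).induce C.supp).IsRoot v → ∃! w, w ∈ S ∧ G.Adj v w) ∧
      (¬ ((G.induce Sᶜ).induce C.supp).IsRoot v → ∀ w ∈ S, ¬ G.Adj v w) ∧
      ∀ w ∈ S, ¬ G.Adj w v

end

end Digraph

/-! ### Squares of eigenvalues and the trace of the squared matrix. -/

namespace Matrix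

/-! The energy is the trace of the squared Laplacian, that is, the sum of the squared outdegrees
plus the number of ordered pairs joined by a digon (arcs in both directions). This leaves a counting
problem.

Put `k = r - 1` and let `S` be a minimal vertex set that is not `k`-colourable. Minimality gives
every vertex of `S` at least `k` out-neighbours in `S` (`le_outdegreeIn_of_minimal`). By
connectivity, each vertex outside `S` accounts for its own arc not inside `S`, and each such arc
adds at least 1 to the energy of `S`. Equality here means that no arc leaves `S`, outside vertices
have outdegree 1, and no digon meets the complement (`coreEnergy_add_card_compl_le`). This local
description is equivalent to hanging in-trees.

It remains to bound the energy of `S` itself. For `k = 1` it is at least `|S|`, with equality only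
for outdegrees 1 and no digons, and then minimality makes `S` a directed cycle of length at least 3.
For `k ≥ 2`, many arcs on few vertices force digons, while on many vertices the squares dominate;
only `|S| = k + 1` is optimal (`coreEnergy_lower_bound`). The one numerical tie, `k = 2` and `|S| =
5`, would be a regular tournament, which is 2-colourable (`colorableOn_two_of_card_eq_five`). -/

theorem charpoly_sq_eq_prod_roots {n K : Type*} [Fintype n] [DecidableEq n] [Field K]
    [IsAlgClosed K] (A : Matrix n n K) :
    (A ^ 2).charpoly =
      ((A.charpoly.roots.map fun z => z ^ 2).map fun z => Polynomial.X - Polynomial.C z).prod := by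
  refine Polynomial.funext fun w => ?_
  obtain ⟨z, rfl⟩ := IsAlgClosed.exists_pow_nat_eq w (n := 2) (by norm_num)
  have hp (x : K) : (scalar n x - A).det = (A.charpoly.roots.map fun a => x - a).prod := by
    rw [← eval_charpoly]
    exact (IsAlgClosed.splits A.charpoly).eval_eq_prod_roots_of_monic A.charpoly_monic x
  -- The second factor is `z + A`, written so that `hp` applies at `-z`; the sign from the
  -- determinant is then absorbed into one factor per root.
  have hfac : scalar n (z ^ 2) - A ^ 2 = (scalar n z - A) * -(scalar n (-z) - A) := by
    have hc : Commute (scalar n z) A := scalar_commute z (fun r => Commute.all _ _) A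
    have h : (scalar n z - A) * -(-scalar n z - A) =
        scalar n z * scalar n z + scalar n z * A - A * scalar n z - A * A := by noncomm_ring
    rw [map_pow, map_neg, h, hc.eq]
    noncomm_ring
  have hcard : Fintype.card n = A.charpoly.roots.card := by
    rw [← (IsAlgClosed.splits A.charpoly).natDegree_eq_card_roots, charpoly_natDegree_eq_dim]
  rw [eval_charpoly, hfac, det_mul, det_neg, hp, hp, hcard, ← Multiset.card_map (fun a => -z - a),
    ← Multiset.prod_map_neg, Multiset.map_map, ← Multiset.prod_map_mul,
    Polynomial.eval_multiset_prod, Multiset.map_map, Multiset.map_map]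
  refine congrArg Multiset.prod (Multiset.map_congr rfl fun a _ => ?_)
  simp only [Function.comp_apply, Polynomial.eval_sub, Polynomial.eval_X, Polynomial.eval_C]
  ring

theorem sum_sq_roots_charpoly {n K : Type*} [Fintype n] [DecidableEq n] [Field K]
    [IsAlgClosed K] (A : Matrix n n K) :
    (A.charpoly.roots.map fun z => z ^ 2).sum = (A ^ 2).trace := by
  rw [trace_eq_sum_roots_charpoly, charpoly_sq_eq_prod_roots, Polynomial.roots_multiset_prod_X_sub_C]

end Matrix

/-! ### The energy as a count of squared outdegrees and digons. -/

namespace Digraph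
variable {V : Type*}

theorem laplacianEnergy_eq_trace [Fintype V] [DecidableEq V] (G : Digraph V) :
    G.laplacianEnergy = (G.lapMatrix ^ 2).trace :=
  Matrix.sum_sq_roots_charpoly _

open Classical in
/-- The number of arcs from `v` to a vertex of `S`. -/
noncomputable def outdegreeIn (G : Digraph V) (S : Finset V) (v : V) : ℕ :=
  (S.filter fun w => G.Adj v w).card

open Classical in
/-- The number of ordered pairs of vertices of `S` that are joined by arcs in both directions. -/
noncomputable def digonCount (G : Digraph V) (S : Finset V) : ℕ :=
  ∑ u ∈ S, (S.filter fun v => G.Adj u v ∧ G.Adj v u).card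

/-- The Laplacian energy of the subdigraph induced by `S`, in combinatorial form. -/
noncomputable def coreEnergy (G : Digraph V) (S : Finset V) : ℕ :=
  ∑ v ∈ S, G.outdegreeIn S v ^ 2 + G.digonCount S

theorem outdegree_eq_outdegreeIn_univ [Fintype V] (G : Digraph V) (v : V) :
    G.outdegree v = G.outdegreeIn Finset.univ v := by
  classical
  rw [outdegree, outdegreeIn, ← Set.ncard_coe_finset]
  simp

theorem laplacianEnergy_eq_coreEnergy [Fintype V] [DecidableEq V] {G : Digraph V}
    (hG : ∀ v, ¬ G.Adj v v) : G.laplacianEnergy = (G.coreEnergy Finset.univ : ℂ) := by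
  classical
  rw [laplacianEnergy_eq_trace, pow_two, Matrix.trace, coreEnergy, digonCount]
  push_cast
  rw [← Finset.sum_add_distrib]
  refine Finset.sum_congr rfl fun u _ => ?_
  rw [Matrix.diag_apply, Matrix.mul_apply, ← Finset.add_sum_erase _ _ (Finset.mem_univ u)]
  congr 1
  · simp [lapMatrix, adjMatrix, hG, outdegree_eq_outdegreeIn_univ, pow_two]
  · rw [Finset.card_filter, ← Finset.add_sum_erase _ _ (Finset.mem_univ u)]
    push_cast
    simp only [hG, and_self, if_false, zero_add]
    refine Finset.sum_congr rfl fun v hv => ?_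
    have h := Finset.ne_of_mem_erase hv
    by_cases h1 : G.Adj u v <;> by_cases h2 : G.Adj v u <;>
      simp [lapMatrix, adjMatrix, Matrix.diagonal_apply_ne _ h, Matrix.diagonal_apply_ne' _ h, h1, h2]

end Digraph

/-! ### Acyclic colourings of vertex subsets and minimal non-colourable sets. -/

namespace Digraph
variable {V : Type*}

/-- No directed cycle of `G` has all its vertices in `s`. -/
def IsAcyclicOn (G : Digraph V) (s : Set V) : Prop :=
  ∀ (l : ℕ) (c : Fin l → V), 0 < l → Function.Injective c → (∀ i, c i ∈ s) →
    ¬ ∀ i, G.Adj (c i) (c (finRotate l i))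

theorem isAcyclic_induce_iff {G : Digraph V} {s : Set V} :
    (G.induce s).IsAcyclic ↔ G.IsAcyclicOn s := by
  constructor
  · intro h l c hl hc hs hadj
    exact h l (fun i => ⟨c i, hs i⟩) hl (fun i j hij => hc (congrArg Subtype.val hij)) hadj
  · intro h l c hl hc hadj
    exact h l (fun i => c i) hl (Subtype.val_injective.comp hc) (fun i => (c i).2) hadj

/-- Along a directed cycle the sum of `f` would strictly increase under rotation, which merely
permutes its terms. -/
theorem isAcyclicOn_of_rank {G : Digraph V} {s : Set V} (f : V → ℕ)
    (hf : ∀ u ∈ s, ∀ v ∈ s, G.Adj u v → f u < f v) : G.IsAcyclicOn s := by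
  intro l c hl _ hs hadj
  have hlt : ∑ i, f (c i) < ∑ i, f (c (finRotate l i)) :=
    Finset.sum_lt_sum_of_nonempty ⟨⟨0, hl⟩, Finset.mem_univ _⟩
      fun i _ => hf _ (hs _) _ (hs _) (hadj i)
  exact hlt.ne (Equiv.sum_comp (finRotate l) fun i => f (c i)).symm

theorem IsAcyclicOn.not_digon {G : Digraph V} {s : Set V} (h : G.IsAcyclicOn s) {u v : V}
    (hu : u ∈ s) (hv : v ∈ s) (hne : u ≠ v) (huv : G.Adj u v) : ¬ G.Adj v u := by
  intro hvu
  refine h 2 ![u, v] two_pos ?_ ?_ ?_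
  · intro i j; fin_cases i <;> fin_cases j <;> simp [hne, hne.symm]
  · intro i; fin_cases i <;> simp [hu, hv]
  · intro i; fin_cases i <;> simpa

/-- The vertices of `S` can be coloured with `k` colours so that no directed cycle in `S` is
monochromatic. -/
def ColorableOn (G : Digraph V) (S : Set V) (k : ℕ) : Prop :=
  ∃ f : V → Fin k, ∀ i, G.IsAcyclicOn {v | v ∈ S ∧ f v = i}

theorem colorableOn_univ_iff {G : Digraph V} {k : ℕ} :
    G.ColorableOn Set.univ k ↔ ∃ f : V → Fin k, G.IsAcyclicColoring f := by
  simp only [ColorableOn, IsAcyclicColoring, isAcyclic_induce_iff]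
  simp [Set.preimage]

theorem not_colorableOn_of_lt_dichromaticNumber {G : Digraph V} {k : ℕ}
    (h : k < G.dichromaticNumber) : ¬ G.ColorableOn Set.univ k := by
  rw [colorableOn_univ_iff]
  exact Nat.notMem_of_lt_sInf h

theorem dichromaticNumber_eq {G : Digraph V} {r : ℕ} (h : G.ColorableOn Set.univ r)
    (h' : ∀ k < r, ¬ G.ColorableOn Set.univ k) : G.dichromaticNumber = r := by
  rw [colorableOn_univ_iff] at h
  refine le_antisymm (Nat.sInf_le h) (le_csInf ⟨r, h⟩ fun k hk => ?_)
  by_contra hlt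
  exact h' k (not_le.mp hlt) (colorableOn_univ_iff.mpr hk)

theorem exists_minimal_not_colorableOn [Fintype V] {G : Digraph V} {k : ℕ}
    (h : ¬ G.ColorableOn Set.univ k) :
    ∃ S : Finset V, Minimal (fun T : Finset V => ¬ G.ColorableOn T k) S :=
  exists_minimal_of_wellFoundedLT _ ⟨Finset.univ, by simpa using h⟩

/-- If `v` had fewer than `k` out-neighbours in `S`, a colouring of `S` without `v` would miss a
colour on them. Giving `v` that colour creates no monochromatic cycle, since such a cycle would
leave `v` through an out-neighbour of the same colour. -/
theorem le_outdegreeIn_of_minimal {G : Digraph V} (hG : ∀ v, ¬ G.Adj v v) {k : ℕ}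
    {S : Finset V} (hS : Minimal (fun T : Finset V => ¬ G.ColorableOn T k) S) {v : V}
    (hv : v ∈ S) : k ≤ G.outdegreeIn S v := by
  classical
  by_contra! hlt
  obtain ⟨f, hf⟩ : G.ColorableOn (S.erase v : Finset V) k := by
    by_contra hcon
    exact Finset.notMem_erase v S (hS.2 hcon (Finset.erase_subset v S) hv)
  obtain ⟨i, hi⟩ : ∃ i, i ∉ (S.filter fun w => G.Adj v w).image f := by
    by_contra! hall
    have := Finset.card_le_card (fun i _ => hall i : (Finset.univ : Finset (Fin k)) ⊆ _)
    rw [Finset.card_univ, Fintype.card_fin] at this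
    exact absurd (this.trans Finset.card_image_le) (not_le.mpr hlt)
  refine hS.1 ⟨Function.update f v i, fun j l c hl hc hs hadj => ?_⟩
  by_cases hvc : ∃ m, c m = v
  · obtain ⟨m, rfl⟩ := hvc
    have hj : i = j := by simpa using (hs m).2
    have hne : c (finRotate l m) ≠ c m := fun h => hG (c m) (by have := hadj m; rwa [h] at this)
    refine hi (Finset.mem_image.mpr ⟨c (finRotate l m),
      Finset.mem_filter.mpr ⟨(hs _).1, hadj m⟩, ?_⟩)
    have := (hs (finRotate l m)).2
    rwa [Function.update_of_ne hne, ← hj] at this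
  · push Not at hvc
    refine hf j l c hl hc (fun m => ⟨?_, ?_⟩) hadj
    · simpa [hvc m] using (hs m).1
    · simpa [Function.update_of_ne (hvc m)] using (hs m).2

theorem nonempty_of_not_colorableOn {G : Digraph V} {k : ℕ} (hk : 0 < k) {S : Finset V}
    (h : ¬ G.ColorableOn S k) : S.Nonempty := by
  rw [Finset.nonempty_iff_ne_empty]
  rintro rfl
  exact h ⟨fun _ => ⟨0, hk⟩, fun i l c hl _ hs => absurd (hs ⟨0, hl⟩).1 (by simp)⟩

end Digraph

/-! ### The cost of the vertices outside the core. -/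

namespace Digraph
variable {V : Type*}

/-- The arcs of `G` outside the core `S` are exactly one arc from each vertex outside `S`, and none
of them lies in a directed cycle of length two. -/
structure HasFunctionalComplement (G : Digraph V) (S : Set V) : Prop where
  not_adj : ∀ u ∈ S, ∀ v ∉ S, ¬ G.Adj u v
  outdegree_eq : ∀ v ∉ S, G.outdegree v = 1
  asymm : ∀ v ∉ S, ∀ w, G.Adj v w → ¬ G.Adj w v

theorem toSimpleGraphInclusive_adj {G : Digraph V} {u v : V} :
    G.toSimpleGraphInclusive.Adj u v ↔ u ≠ v ∧ (G.Adj u v ∨ G.Adj v u) :=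
  SimpleGraph.fromRel_adj _ _ _

theorem _root_.SimpleGraph.Connected.exists_adj_dist_lt {H : SimpleGraph V} (hH : H.Connected)
    {u v : V} (hne : u ≠ v) : ∃ w, H.Adj u w ∧ H.dist w v < H.dist u v := by
  obtain ⟨p, hp⟩ := hH.exists_walk_length_eq_dist u v
  cases p with
  | nil => exact absurd rfl hne
  | cons h q =>
    refine ⟨_, h, ?_⟩
    rw [← hp, SimpleGraph.Walk.length_cons]
    exact Nat.lt_succ_of_le (SimpleGraph.dist_le q)

section
variable [Fintype V] [DecidableEq V] {G : Digraph V} {S : Finset V}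

theorem outdegreeIn_univ (v : V) :
    G.outdegreeIn Finset.univ v = G.outdegreeIn S v + G.outdegreeIn Sᶜ v := by
  classical
  rw [outdegreeIn, outdegreeIn, outdegreeIn, ← Finset.card_union_of_disjoint, ← Finset.filter_union,
    Finset.union_compl]
  exact Finset.disjoint_filter_filter disjoint_compl_right

/-- Each outside vertex selects an arc, in either direction, joining it to a neighbour closer to a
fixed `s ∈ S` in the underlying graph. Two vertices cannot select the same arc, as each would then
be closer to `s` than the other. -/
theorem card_compl_le_arcs (hG : G.toSimpleGraphInclusive.Connected) (hS : S.Nonempty) :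
    Sᶜ.card ≤ ∑ u ∈ S, G.outdegreeIn Sᶜ u + ∑ u ∈ Sᶜ, G.outdegreeIn Finset.univ u := by
  classical
  obtain ⟨s, hs⟩ := hS
  have hex : ∀ v : V, ∃ w, v ∈ Sᶜ → G.toSimpleGraphInclusive.Adj v w ∧
      G.toSimpleGraphInclusive.dist w s < G.toSimpleGraphInclusive.dist v s := by
    intro v
    by_cases hv : v ∈ Sᶜ
    · obtain ⟨w, hw⟩ := hG.exists_adj_dist_lt (u := v) (v := s)
        (by rintro rfl; exact Finset.mem_compl.mp hv hs)
      exact ⟨w, fun _ => hw⟩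
    · exact ⟨v, fun h => absurd h hv⟩
  choose next hnext using hex
  have hsum : ∑ u ∈ S, G.outdegreeIn Sᶜ u + ∑ u ∈ Sᶜ, G.outdegreeIn Finset.univ u =
      (Finset.univ.sigma fun u : V =>
        (if u ∈ S then Sᶜ else Finset.univ).filter fun w => G.Adj u w).card := by
    rw [Finset.card_sigma, ← Finset.sum_add_sum_compl S]
    congr 1
    · exact Finset.sum_congr rfl fun u hu => by rw [if_pos hu, outdegreeIn]
    · exact Finset.sum_congr rfl fun u hu => by rw [if_neg (Finset.mem_compl.mp hu), outdegreeIn]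
  rw [hsum]
  refine Finset.card_le_card_of_injOn
    (fun v => if G.Adj v (next v) then ⟨v, next v⟩ else ⟨next v, v⟩) ?_ ?_
  · intro v hv
    have hv' : v ∉ S := by simpa using hv
    have h := (toSimpleGraphInclusive_adj.mp (hnext v hv).1).2
    by_cases hadj : G.Adj v (next v)
    · simp [hadj, hv']
    · have h' := h.resolve_left hadj
      by_cases hn : next v ∈ S <;> simp [hadj, hn, hv', h']
  · intro v hv w hw hvw
    have h1 := (hnext v hv).2
    have h2 := (hnext w hw).2
    dsimp only at hvw
    split_ifs at hvw <;> simp only [Sigma.mk.injEq, heq_eq_eq] at hvw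
    · exact hvw.1
    · rw [hvw.2] at h1; rw [← hvw.1] at h2; omega
    · rw [hvw.1] at h1; rw [← hvw.2] at h2; omega
    · exact hvw.2

open Classical in
theorem digonCount_add_le :
    G.digonCount S + ∑ u ∈ Sᶜ, (Finset.univ.filter fun v => G.Adj u v ∧ G.Adj v u).card ≤
      G.digonCount Finset.univ := by
  rw [digonCount, digonCount, ← Finset.sum_add_sum_compl S]
  gcongr
  exact Finset.subset_univ _

/-- A vertex with `a ≥ 1` out-neighbours in `S` and `b` outside satisfies `(a + b)² ≥ a² + 2b`, so
an arc leaving `S` costs at least 2 but is counted only once in `card_compl_le_arcs`. Equality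
therefore excludes such arcs; the remaining slack forces outdegree 1 and no digons outside. -/
theorem coreEnergy_add_card_compl_le (hG : G.toSimpleGraphInclusive.Connected)
    (hS : S.Nonempty) (hout : ∀ v ∈ S, 1 ≤ G.outdegreeIn S v) :
    G.coreEnergy S + Sᶜ.card ≤ G.coreEnergy Finset.univ ∧
      (G.coreEnergy Finset.univ = G.coreEnergy S + Sᶜ.card → G.HasFunctionalComplement S) := by
  classical
  have h1 := card_compl_le_arcs hG hS
  have h2 := digonCount_add_le (G := G) (S := S)
  have h3 : ∑ v ∈ S, G.outdegreeIn S v ^ 2 + 2 * ∑ v ∈ S, G.outdegreeIn Sᶜ v ≤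
      ∑ v ∈ S, G.outdegreeIn Finset.univ v ^ 2 := by
    rw [Finset.mul_sum, ← Finset.sum_add_distrib]
    refine Finset.sum_le_sum fun v hv => ?_
    rw [outdegreeIn_univ (S := S)]
    nlinarith [hout v hv, Nat.zero_le (G.outdegreeIn Sᶜ v),
      Nat.mul_le_mul_right (G.outdegreeIn Sᶜ v) (hout v hv)]
  have h4 : ∀ v ∈ Sᶜ, G.outdegreeIn Finset.univ v ≤ G.outdegreeIn Finset.univ v ^ 2 :=
    fun v _ => Nat.le_self_pow two_ne_zero _
  have h5 := Finset.sum_le_sum h4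
  have h6 : G.coreEnergy Finset.univ = ∑ v ∈ S, G.outdegreeIn Finset.univ v ^ 2 +
      ∑ v ∈ Sᶜ, G.outdegreeIn Finset.univ v ^ 2 + G.digonCount Finset.univ := by
    rw [coreEnergy, ← Finset.sum_add_sum_compl S]
  have h7 : G.coreEnergy S = ∑ v ∈ S, G.outdegreeIn S v ^ 2 + G.digonCount S := rfl
  refine ⟨by omega, fun heq => ?_⟩
  have hx : ∑ v ∈ S, G.outdegreeIn Sᶜ v = 0 := by omega
  have hD : ∑ u ∈ Sᶜ, (Finset.univ.filter fun v => G.Adj u v ∧ G.Adj v u).card = 0 := by omega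
  have hYZ : ∑ v ∈ Sᶜ, G.outdegreeIn Finset.univ v = ∑ v ∈ Sᶜ, G.outdegreeIn Finset.univ v ^ 2 := by
    omega
  have hY : ∑ v ∈ Sᶜ, G.outdegreeIn Finset.univ v = ∑ v ∈ Sᶜ, 1 := by
    rw [Finset.sum_const, smul_eq_mul, mul_one]; omega
  have hle : ∀ v ∈ Sᶜ, G.outdegreeIn Finset.univ v ≤ 1 := fun v hv => by
    have := (Finset.sum_eq_sum_iff_of_le h4).mp hYZ v hv
    nlinarith
  refine ⟨fun u hu v hv hadj => ?_, fun v hv => ?_, fun v hv w h h' => ?_⟩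
  · have := (Finset.sum_eq_zero_iff.mp hx) u hu
    rw [outdegreeIn, Finset.card_eq_zero, Finset.filter_eq_empty_iff] at this
    exact this (Finset.mem_compl.mpr hv) hadj
  · rw [outdegree_eq_outdegreeIn_univ]
    exact (Finset.sum_eq_sum_iff_of_le hle).mp hY v (Finset.mem_compl.mpr hv)
  · have := (Finset.sum_eq_zero_iff.mp hD) v (Finset.mem_compl.mpr hv)
    rw [Finset.card_eq_zero, Finset.filter_eq_empty_iff] at this
    exact this (Finset.mem_univ w) ⟨h, h'⟩

theorem HasFunctionalComplement.coreEnergy_univ (h : G.HasFunctionalComplement S) :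
    G.coreEnergy Finset.univ = G.coreEnergy S + Sᶜ.card := by
  classical
  have h1 : ∀ v ∈ S, G.outdegreeIn Finset.univ v ^ 2 = G.outdegreeIn S v ^ 2 := fun v hv => by
    have : G.outdegreeIn Sᶜ v = 0 := by
      rw [outdegreeIn, Finset.card_eq_zero, Finset.filter_eq_empty_iff]
      exact fun w hw => h.not_adj v hv w (Finset.mem_compl.mp hw)
    rw [outdegreeIn_univ (S := S), this, add_zero]
  have h2 : ∀ v ∈ Sᶜ, G.outdegreeIn Finset.univ v ^ 2 = 1 := fun v hv => by
    rw [← outdegree_eq_outdegreeIn_univ, h.outdegree_eq v (Finset.mem_compl.mp hv), one_pow]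
  have h3 : G.digonCount Finset.univ = G.digonCount S := by
    rw [digonCount, digonCount, ← Finset.sum_add_sum_compl S, Nat.add_eq_left.mpr]
    · refine Finset.sum_congr rfl fun u hu => congrArg Finset.card (Finset.ext fun v => ?_)
      simp only [Finset.mem_filter, Finset.mem_univ, true_and]
      refine ⟨fun hv => ⟨?_, hv⟩, fun hv => hv.2⟩
      by_contra hvS
      exact h.not_adj u hu v hvS hv.1
    · refine Finset.sum_eq_zero fun u hu => ?_
      rw [Finset.card_eq_zero, Finset.filter_eq_empty_iff]
      exact fun v _ hv => h.asymm u (Finset.mem_compl.mp hu) v hv.1 hv.2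
  rw [coreEnergy, ← Finset.sum_add_sum_compl S, Finset.sum_congr rfl h1, Finset.sum_congr rfl h2, h3,
    coreEnergy, Finset.sum_const, smul_eq_mul, mul_one]
  omega

end

end Digraph

/-! ### The energy of the core. -/

namespace Digraph
variable {V : Type*} {G : Digraph V} {S : Finset V}

theorem outdegreeIn_lt_card (hG : ∀ v, ¬ G.Adj v v) {v : V} (hv : v ∈ S) :
    G.outdegreeIn S v < S.card := by
  classical
  refine Finset.card_lt_card (Finset.filter_ssubset.mpr ⟨v, hv, hG v⟩)

/-- Each ordered pair of distinct vertices satisfies `[u → v] + [v → u] ≤ 1 + [digon]`; summing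
shows that an excess of arcs forces digons. -/
theorem two_mul_sum_outdegreeIn_le (hG : ∀ v, ¬ G.Adj v v) :
    2 * ∑ v ∈ S, G.outdegreeIn S v ≤ G.digonCount S + S.card * (S.card - 1) := by
  classical
  have h1 : ∑ v ∈ S, G.outdegreeIn S v = ∑ u ∈ S, ∑ v ∈ S, if G.Adj u v then 1 else 0 :=
    Finset.sum_congr rfl fun u _ => Finset.card_filter _ _
  have h2 : S.card * (S.card - 1) = ∑ u ∈ S, ∑ v ∈ S, if v ≠ u then 1 else 0 := by
    rw [← smul_eq_mul, ← Finset.sum_const]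
    refine Finset.sum_congr rfl fun u hu => ?_
    rw [← Finset.card_filter, Finset.filter_ne', Finset.card_erase_of_mem hu]
  have h3 : G.digonCount S = ∑ u ∈ S, ∑ v ∈ S, if G.Adj u v ∧ G.Adj v u then 1 else 0 :=
    Finset.sum_congr rfl fun u _ => Finset.card_filter _ _
  rw [two_mul, h2, h3]
  nth_rw 2 [h1.trans Finset.sum_comm]
  rw [h1, ← Finset.sum_add_distrib, ← Finset.sum_add_distrib]
  refine Finset.sum_le_sum fun u _ => ?_
  rw [← Finset.sum_add_distrib, ← Finset.sum_add_distrib]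
  refine Finset.sum_le_sum fun v _ => ?_
  by_cases huv : v = u
  · subst huv; simp [hG]
  · by_cases h : G.Adj u v <;> by_cases h' : G.Adj v u <;> simp [h, h', huv]

theorem digonCount_eq_zero_iff :
    G.digonCount S = 0 ↔ ∀ u ∈ S, ∀ v ∈ S, G.Adj u v → ¬ G.Adj v u := by
  classical
  simp [digonCount, Finset.filter_eq_empty_iff]

/-- Positivity of the ranks keeps the value 0 free for a further vertex placed before `a` and `b`.
-/
theorem exists_rank_of_not_digon [DecidableEq V] (hG : ∀ v, ¬ G.Adj v v) {a b : V}
    (hab : G.Adj a b → ¬ G.Adj b a) :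
    ∃ f : V → ℕ, (∀ w, 0 < f w) ∧
      ∀ u ∈ ({a, b} : Finset V), ∀ v ∈ ({a, b} : Finset V), G.Adj u v → f u < f v := by
  have hne : ∀ u v, G.Adj u v → u ≠ v := by rintro u _ h rfl; exact hG u h
  by_cases h : G.Adj a b
  · refine ⟨fun w => if w = a then 1 else 2, fun w => by dsimp only; split_ifs <;> simp, ?_⟩
    simp only [Finset.mem_insert, Finset.mem_singleton]
    rintro u (rfl | rfl) v (rfl | rfl) huv <;> simp_all
    rw [if_neg (Ne.symm (hne _ _ huv))]
    exact one_lt_two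
  · refine ⟨fun w => if w = b then 1 else 2, fun w => by dsimp only; split_ifs <;> simp, ?_⟩
    simp only [Finset.mem_insert, Finset.mem_singleton]
    rintro u (rfl | rfl) v (rfl | rfl) huv <;> simp_all
    rw [if_neg (Ne.symm (hne _ _ huv))]
    exact one_lt_two

/-- One class is a vertex `v` with its two out-neighbours: without digons no arc returns to `v`, so
it is acyclic. The other class has only two vertices, not joined by a digon. -/
theorem colorableOn_two_of_card_eq_five (hG : ∀ v, ¬ G.Adj v v) (hS : S.card = 5)
    (hout : ∀ v ∈ S, G.outdegreeIn S v = 2)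
    (hdigon : ∀ u ∈ S, ∀ v ∈ S, G.Adj u v → ¬ G.Adj v u) : G.ColorableOn S 2 := by
  classical
  obtain ⟨v, hv⟩ : S.Nonempty := Finset.card_pos.mp (by omega)
  obtain ⟨a, b, -, hN⟩ := Finset.card_eq_two.mp (hout v hv)
  set N := S.filter fun w => G.Adj v w with hNdef
  have hvN : v ∉ N := by simp [hNdef, hG]
  have hNS : insert v N ⊆ S := Finset.insert_subset hv (Finset.filter_subset _ _)
  have hNcard : N.card = 2 := hout v hv
  obtain ⟨c, d, -, hR⟩ : ∃ c d, c ≠ d ∧ S \ insert v N = {c, d} := by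
    rw [← Finset.card_eq_two, Finset.card_sdiff_of_subset hNS, Finset.card_insert_of_notMem hvN]
    omega
  have hmem : ∀ w ∈ N, w ∈ S ∧ G.Adj v w := fun w hw => Finset.mem_filter.mp hw
  have hab : G.Adj a b → ¬ G.Adj b a :=
    hdigon a (hmem a (by simp [hN])).1 b (hmem b (by simp [hN])).1
  have hRS : ∀ w ∈ ({c, d} : Finset V), w ∈ S := fun w hw =>
    (Finset.mem_sdiff.mp (hR ▸ hw)).1
  have hcd : G.Adj c d → ¬ G.Adj d c := hdigon c (hRS c (by simp)) d (hRS d (by simp))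
  obtain ⟨f, hf0, hf⟩ := exists_rank_of_not_digon hG hab
  obtain ⟨g, -, hg⟩ := exists_rank_of_not_digon hG hcd
  rw [← hN] at hf
  rw [← hR] at hg
  refine ⟨fun w => if w ∈ insert v N then 0 else 1, fun i => ?_⟩
  fin_cases i
  · refine isAcyclicOn_of_rank (fun w => if w = v then 0 else f w) ?_
    rintro x ⟨-, hx⟩ y ⟨-, hy⟩ hxy
    have hx' : x ∈ insert v N := by by_contra h; simp [h] at hx
    have hy' : y ∈ insert v N := by by_contra h; simp [h] at hy
    rw [Finset.mem_insert] at hx' hy'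
    have hyv : y ≠ v := by
      rintro rfl
      rcases hx' with rfl | hx'
      · exact hG _ hxy
      · exact hdigon _ hv _ (hmem x hx').1 (hmem x hx').2 hxy
    rcases hx' with rfl | hx'
    · simpa [hyv] using hf0 y
    · have hxv : x ≠ v := by rintro rfl; exact hvN hx'
      simpa [hyv, hxv] using hf x hx' y (hy'.resolve_left hyv) hxy
  · refine isAcyclicOn_of_rank g ?_
    rintro x ⟨hxS, hx⟩ y ⟨hyS, hy⟩ hxy
    have hx' : x ∉ insert v N := by intro h; simp [h] at hx
    have hy' : y ∉ insert v N := by intro h; simp [h] at hy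
    exact hg x (Finset.mem_sdiff.mpr ⟨hxS, hx'⟩) y (Finset.mem_sdiff.mpr ⟨hyS, hy'⟩) hxy

/-- The Laplacian energy of a set of minimal outdegree `k` that cannot be coloured with `k` colours
is bounded below, strictly unless the set has only `k + 1` vertices. -/
theorem coreEnergy_lower_bound (hG : ∀ v, ¬ G.Adj v v) {k : ℕ} (hk : 2 ≤ k)
    (hS : ¬ G.ColorableOn S k) (hout : ∀ v ∈ S, k ≤ G.outdegreeIn S v) :
    (k + 1) ^ 2 * k + S.card ≤ G.coreEnergy S + (k + 1) ∧
      (G.coreEnergy S + (k + 1) = (k + 1) ^ 2 * k + S.card → S.card = k + 1) := by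
  obtain ⟨v, hv⟩ := nonempty_of_not_colorableOn (by omega) hS
  have hcard : k + 1 ≤ S.card := (hout v hv).trans_lt (outdegreeIn_lt_card hG hv)
  have hsq : ∀ v ∈ S, k ^ 2 ≤ G.outdegreeIn S v ^ 2 := fun v hv => Nat.pow_le_pow_left (hout v hv) 2
  have h1 : S.card * k ^ 2 ≤ ∑ v ∈ S, G.outdegreeIn S v ^ 2 := by
    rw [← smul_eq_mul, ← Finset.sum_const]; exact Finset.sum_le_sum hsq
  have h2 : S.card * k ≤ ∑ v ∈ S, G.outdegreeIn S v := by
    rw [← smul_eq_mul, ← Finset.sum_const]; exact Finset.sum_le_sum hout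
  have h3 := two_mul_sum_outdegreeIn_le (S := S) hG
  have h4 : G.coreEnergy S = ∑ v ∈ S, G.outdegreeIn S v ^ 2 + G.digonCount S := rfl
  obtain ⟨t, ht⟩ := Nat.exists_eq_add_of_le hcard
  have hlt : 0 < t → (k + 1) ^ 2 * k + S.card < G.coreEnergy S + (k + 1) := by
    intro htpos
    rw [ht] at h1 h2 h3 ⊢
    rw [show k + 1 + t - 1 = k + t by omega] at h3
    -- The combined bounds on squares and digons leave a margin of `k² - 3` for `t = 1` and `2k² -
    -- 8` for `t = 2`, the latter vanishing exactly at `k = 2`. For `t ≥ 3` the squares alone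
    -- suffice.
    rcases (by omega : t = 1 ∨ t = 2 ∨ 3 ≤ t) with rfl | rfl | h
    · nlinarith
    · rcases (by omega : k = 2 ∨ 3 ≤ k) with rfl | hk3
      · by_contra! hle
        norm_num at h1 h2 h3 hle
        -- In the tie all estimates are sharp: every outdegree is 2 and there is no digon.
        have hsum : ∑ v ∈ S, 2 ^ 2 = ∑ v ∈ S, G.outdegreeIn S v ^ 2 := by
          rw [Finset.sum_const, smul_eq_mul, ht]; omega
        refine hS (colorableOn_two_of_card_eq_five hG ht (fun v hv => ?_)
          (digonCount_eq_zero_iff.mp (by omega)))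
        have := (Finset.sum_eq_sum_iff_of_le hsq).mp hsum v hv
        exact (Nat.pow_left_injective two_ne_zero this).symm
      · nlinarith
    · nlinarith [Nat.mul_le_mul h (Nat.pow_le_pow_left hk 2), Nat.mul_le_mul hk hk,
        Nat.mul_le_mul_right (k ^ 2) h]
  rcases Nat.eq_zero_or_pos t with rfl | htpos
  · rw [ht] at h1 h2 h3 ⊢
    simp only [add_zero, Nat.add_sub_cancel] at h1 h2 h3 ⊢
    exact ⟨by nlinarith, fun _ => trivial⟩
  · have := hlt htpos
    exact ⟨this.le, fun h => absurd h this.ne'⟩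

end Digraph

/-! ### Hanging in-trees and their local characterisation. -/

namespace Digraph
variable {V : Type*} {G : Digraph V}

theorem outdegree_eq_zero_iff [Finite V] {v : V} : G.outdegree v = 0 ↔ ∀ w, ¬ G.Adj v w := by
  rw [outdegree, Set.ncard_eq_zero, Set.eq_empty_iff_forall_notMem]
  rfl

theorem outdegree_eq_one_iff {v : V} : G.outdegree v = 1 ↔ ∃! w, G.Adj v w := by
  rw [outdegree, Set.ncard_eq_one, ExistsUnique]
  simp only [Set.eq_singleton_iff_unique_mem, Set.mem_ofPred_eq]

theorem outdegree_le_one_iff [Finite V] {v : V} :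
    G.outdegree v ≤ 1 ↔ ∀ a b, G.Adj v a → G.Adj v b → a = b := by
  rw [outdegree, Set.ncard_le_one]
  exact ⟨fun h a b ha hb => h a ha b hb, fun h a ha b hb => h a b ha hb⟩

theorem toSimpleGraphInclusive_induce (s : Set V) :
    (G.induce s).toSimpleGraphInclusive = G.toSimpleGraphInclusive.induce s := by
  ext u v
  simp only [SimpleGraph.comap_adj, toSimpleGraphInclusive_adj, induce, Function.Embedding.subtype_apply,
    ne_eq, Subtype.ext_iff]

theorem Component.mem_supp_of_adj {C : G.Component} {u v : V} (hu : u ∈ C.supp)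
    (h : G.Adj u v ∨ G.Adj v u) : v ∈ C.supp := by
  by_cases hne : u = v
  · exact hne ▸ hu
  · exact C.mem_supp_of_adj_mem_supp hu (toSimpleGraphInclusive_adj.mpr ⟨hne, h⟩)

/-- A connected digraph with all outdegrees at most one and one vertex of outdegree zero is an
orientation of a tree. -/
theorem isTree_of_outdegree_le_one [Finite V] (hconn : G.toSimpleGraphInclusive.Connected)
    (hout : ∀ v, G.outdegree v ≤ 1) {ρ : V} (hρ : G.outdegree ρ = 0) :
    G.toSimpleGraphInclusive.IsTree := by
  refine SimpleGraph.isTree_iff_connected_and_card.mpr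
    ⟨hconn, le_antisymm ?_ hconn.card_vert_le_card_edgeSet_add_one⟩
  have htail : ∀ e : G.toSimpleGraphInclusive.edgeSet, ∃ x y, G.Adj x y ∧ e.1 = s(x, y) := by
    rintro ⟨e, he⟩
    induction e with
    | h x y =>
      rcases (toSimpleGraphInclusive_adj.mp he).2 with h | h
      · exact ⟨x, y, h, rfl⟩
      · exact ⟨y, x, h, Sym2.eq_swap⟩
  choose x y hadj he using htail
  rw [← Finite.card_option]
  -- Each edge goes to its tail and the extra element to `ρ`, which is nobody's tail; outdegree at
  -- most one makes tails determine edges. Hence there are fewer edges than vertices.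
  refine Nat.card_le_card_of_injective (fun o => o.elim ρ x) ?_
  rintro (_ | e) (_ | e') h
  · rfl
  · have hx : ρ = x e' := h
    exact absurd (hx ▸ hadj e') (outdegree_eq_zero_iff.mp hρ _)
  · have hx : x e = ρ := h
    exact absurd (hx ▸ hadj e) (outdegree_eq_zero_iff.mp hρ _)
  · have hx : x e = x e' := h
    have hy : y e = y e' := outdegree_le_one_iff.mp (hout (x e)) _ _ (hadj e) (hx ▸ hadj e')
    rw [Subtype.ext (by rw [he e, he e', hx, hy] : e.1 = e'.1)]

theorem HasFunctionalComplement.hasHangingInTrees [Finite V]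
    (hconn : G.toSimpleGraphInclusive.Connected) {S : Set V} (hS : S.Nonempty)
    (h : G.HasFunctionalComplement S) : G.HasHangingInTrees S := by
  intro C
  set T := (G.induce Sᶜ).induce C.supp with hT
  have huniq : ∀ (x : C.supp) (a b : V), G.Adj x a → G.Adj x b → a = b := fun x a b =>
    outdegree_le_one_iff.mp (h.outdegree_eq _ x.1.2).le a b
  have hout : ∀ x, T.outdegree x ≤ 1 := fun x => outdegree_le_one_iff.mpr fun a b ha hb =>
    Subtype.ext (Subtype.ext (huniq x _ _ ha hb))
  have hTconn : T.toSimpleGraphInclusive.Connected := by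
    rw [hT, toSimpleGraphInclusive_induce (G := G.induce Sᶜ) C.supp]
    exact C.connected_toSimpleGraph
  have hmemC : ∀ (x : C.supp) (w : V) (hw : w ∉ S), G.Adj x w → (⟨w, hw⟩ : ↥Sᶜ) ∈ C.supp :=
    fun x w hw hadj => Component.mem_supp_of_adj x.2 (Or.inl hadj)
  obtain ⟨ρ, hρ⟩ : ∃ ρ, T.outdegree ρ = 0 := by
    obtain ⟨s, hs⟩ := hS
    obtain ⟨x⟩ := hTconn.nonempty
    obtain ⟨p⟩ := hconn.preconnected x.1.1 s
    -- A walk to `S` must leave the component, and can do so only into `S`. Since no arc leaves `S`,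
    -- the crossing arc starts in the component; it is the only arc from its tail, which is
    -- therefore the root.
    obtain ⟨d, -, ⟨a, ha, had⟩, hd⟩ := p.exists_boundary_dart (Subtype.val '' C.supp)
      ⟨x.1, x.2, rfl⟩ (by rintro ⟨y, -, rfl⟩; exact y.2 hs)
    have hadj := (toSimpleGraphInclusive_adj.mp d.adj).2
    rw [← had] at hadj
    have hdS : d.snd ∈ S := by
      by_contra hn
      exact hd ⟨⟨d.snd, hn⟩, Component.mem_supp_of_adj (G := G.induce Sᶜ) ha hadj, rfl⟩
    have hadj' : G.Adj a d.snd := hadj.resolve_right (h.not_adj _ hdS _ a.2)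
    refine ⟨⟨a, ha⟩, outdegree_eq_zero_iff.mpr fun w hw => ?_⟩
    have := huniq ⟨a, ha⟩ _ _ hadj' hw
    exact w.1.2 (this ▸ hdS)
  refine ⟨⟨⟨isTree_of_outdegree_le_one hTconn hout hρ, fun u v huv => ?_⟩, hout⟩,
    fun v => ⟨fun hv => ?_, fun hv w hw hadj => ?_, fun w hw => h.not_adj w hw _ v.1.2⟩⟩
  · exact h.asymm _ u.1.2 _ huv
  · obtain ⟨w, hw, hw'⟩ := outdegree_eq_one_iff.mp (h.outdegree_eq _ v.1.2)
    refine ⟨w, ⟨?_, hw⟩, fun y hy => hw' y hy.2⟩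
    by_contra hn
    exact outdegree_eq_zero_iff.mp hv ⟨⟨w, hn⟩, hmemC v w hn hw⟩ hw
  · refine hv (outdegree_eq_zero_iff.mpr fun y hy => ?_)
    exact y.1.2 (huniq v _ _ hadj hy ▸ hw)

/-- An arc from an outside vertex ends in `S` or in the same component. A root has only its arc into
`S`, a non-root only its arc inside the tree. -/
theorem HasHangingInTrees.hasFunctionalComplement [Finite V] {S : Set V}
    (h : G.HasHangingInTrees S) : G.HasFunctionalComplement S := by
  have key : ∀ v (hv : v ∉ S), ∃ C : (G.induce Sᶜ).Component, (⟨v, hv⟩ : ↥Sᶜ) ∈ C.supp :=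
    fun v hv => ⟨_, SimpleGraph.ConnectedComponent.connectedComponentMk_mem⟩
  refine ⟨fun u hu v hv => ?_, fun v hv => ?_, fun v hv w hvw hwv => ?_⟩
  · obtain ⟨C, hC⟩ := key v hv
    exact ((h C).2 ⟨_, hC⟩).2.2 u hu
  · obtain ⟨C, hC⟩ := key v hv
    obtain ⟨⟨-, hout⟩, hrest⟩ := h C
    obtain ⟨hroot, hnroot, -⟩ := hrest ⟨_, hC⟩
    have hmem : ∀ w (hw : w ∉ S), G.Adj v w → (⟨w, hw⟩ : ↥Sᶜ) ∈ C.supp := fun w hw hadj =>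
      Component.mem_supp_of_adj (G := G.induce Sᶜ) hC (Or.inl hadj)
    rw [outdegree_eq_one_iff]
    by_cases hr : ((G.induce Sᶜ).induce C.supp).IsRoot ⟨_, hC⟩
    · obtain ⟨w, ⟨hwS, hw⟩, huniq⟩ := hroot hr
      refine ⟨w, hw, fun y hy => ?_⟩
      by_cases hyS : y ∈ S
      · exact huniq y ⟨hyS, hy⟩
      · exact absurd hy (outdegree_eq_zero_iff.mp hr ⟨⟨y, hyS⟩, hmem y hyS hy⟩)
    · have h1 : ((G.induce Sᶜ).induce C.supp).outdegree ⟨_, hC⟩ = 1 :=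
        le_antisymm (hout _) (Nat.one_le_iff_ne_zero.mpr hr)
      obtain ⟨w, hw, huniq⟩ := outdegree_eq_one_iff.mp h1
      refine ⟨w.1.1, hw, fun y hy => ?_⟩
      have hyS : y ∉ S := fun hyS => hnroot hr y hyS hy
      exact congrArg (fun z => z.1.1) (huniq ⟨⟨y, hyS⟩, hmem y hyS hy⟩ hy)
  · obtain ⟨C, hC⟩ := key v hv
    by_cases hw : w ∈ S
    · exact ((h C).2 ⟨_, hC⟩).2.2 w hw hwv
    · have hwC : (⟨w, hw⟩ : ↥Sᶜ) ∈ C.supp :=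
        Component.mem_supp_of_adj (G := G.induce Sᶜ) hC (Or.inl hvw)
      exact (h C).1.1.2 ⟨_, hC⟩ ⟨_, hwC⟩ hvw hwv

end Digraph

/-! ### Directed cycles and bidirected complete graphs as cores. -/

namespace Digraph
variable {V : Type*} {G : Digraph V} {S : Finset V}

/-- Failure of 1-colourability means that `S` contains a directed cycle, and minimality makes it
span `S`. Outdegree 1 excludes chords; the absence of loops and digons gives length at least 3. -/
theorem exists_isIsomorphic_directedCycle_of_minimal (hG : ∀ v, ¬ G.Adj v v)
    (hS : Minimal (fun T : Finset V => ¬ G.ColorableOn T 1) S)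
    (hout : ∀ v ∈ S, G.outdegreeIn S v = 1)
    (hdigon : ∀ u ∈ S, ∀ v ∈ S, G.Adj u v → ¬ G.Adj v u) :
    ∃ l, 3 ≤ l ∧ (G.induce (S : Set V)).IsIsomorphic (directedCycle l) := by
  classical
  obtain ⟨l, c, hl, hc, hcS, hadj⟩ : ∃ (l : ℕ) (c : Fin l → V), 0 < l ∧ Function.Injective c ∧
      (∀ i, c i ∈ S) ∧ ∀ i, G.Adj (c i) (c (finRotate l i)) := by
    by_contra! hcon
    refine hS.1 ⟨fun _ => 0, fun i l c hl hc hs hadj => ?_⟩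
    obtain ⟨j, hj⟩ := hcon l c hl hc fun i => (hs i).1
    exact hj (hadj j)
  have hle : S ⊆ Finset.univ.image c := by
    refine hS.2 ?_ (Finset.image_subset_iff.mpr fun i _ => hcS i)
    rintro ⟨f, hf⟩
    exact hf 0 l c hl hc (fun i => ⟨by simp, Subsingleton.elim _ _⟩) hadj
  have hbij : Function.Bijective fun i => (⟨c i, hcS i⟩ : (S : Set V)) := by
    refine ⟨fun i j hij => hc (congrArg Subtype.val hij), fun ⟨v, hv⟩ => ?_⟩
    obtain ⟨i, -, hi⟩ := Finset.mem_image.mp (hle hv)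
    exact ⟨i, Subtype.ext hi⟩
  have huniq : ∀ i j, G.Adj (c i) (c j) → finRotate l i = j := by
    intro i j hij
    have h1 := Finset.card_le_one.mp (hout (c i) (hcS i)).le
    exact hc (h1 _ (Finset.mem_filter.mpr ⟨hcS _, hadj i⟩) _ (Finset.mem_filter.mpr ⟨hcS _, hij⟩))
  refine ⟨l, ?_, ⟨RelIso.symm ⟨Equiv.ofBijective _ hbij, fun {i j} => ?_⟩⟩⟩
  · by_contra! hlt
    obtain rfl | rfl : l = 1 ∨ l = 2 := by omega
    · have h := hadj 0
      rw [Subsingleton.elim (finRotate 1 0) 0] at h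
      exact hG _ h
    · exact hdigon _ (hcS 0) _ (hcS 1) (hadj 0) (hadj 1)
  · exact ⟨huniq i j, fun h => h ▸ hadj i⟩

theorem finRotate_finRotate_ne {l : ℕ} (hl : 3 ≤ l) (i : Fin l) :
    finRotate l (finRotate l i) ≠ i := by
  obtain ⟨m, rfl⟩ : ∃ m, l = m + 2 + 1 := ⟨l - 3, by omega⟩
  intro h
  rw [finRotate_apply, finRotate_apply, add_assoc i 1 1, add_eq_left, Fin.ext_iff,
    Fin.val_add, Fin.val_one, Fin.val_zero, Nat.mod_eq_of_lt (by omega)] at h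
  omega

theorem coreEnergy_of_isIsomorphic_directedCycle {l : ℕ} (hl : 3 ≤ l)
    (h : (G.induce (S : Set V)).IsIsomorphic (directedCycle l)) : G.coreEnergy S = S.card := by
  classical
  obtain ⟨e⟩ := h
  have hadj : ∀ (u v : S), G.Adj u v ↔ finRotate l (e u) = e v := fun u v => e.map_rel_iff.symm
  have hout : ∀ v ∈ S, G.outdegreeIn S v ^ 2 = 1 := by
    intro v hv
    rw [outdegreeIn, Finset.card_eq_one.mpr, one_pow]
    refine ⟨e.symm (finRotate l (e ⟨v, hv⟩)), Finset.ext fun w => ?_⟩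
    rw [Finset.mem_filter, Finset.mem_singleton]
    constructor
    · rintro ⟨hw, h⟩
      rw [(hadj ⟨v, hv⟩ ⟨w, hw⟩).mp h, RelIso.symm_apply_apply]
    · rintro rfl
      exact ⟨Subtype.property _, (hadj ⟨v, hv⟩ _).mpr (RelIso.apply_symm_apply _ _).symm⟩
  have hdigon : G.digonCount S = 0 := by
    refine digonCount_eq_zero_iff.mpr fun u hu v hv huv hvu => ?_
    have h1 := (hadj ⟨u, hu⟩ ⟨v, hv⟩).mp huv
    have h2 := (hadj ⟨v, hv⟩ ⟨u, hu⟩).mp hvu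
    exact finRotate_finRotate_ne hl _ (h1.symm ▸ h2)
  rw [coreEnergy, hdigon, Finset.sum_congr rfl hout, Finset.sum_const, smul_eq_mul, mul_one, add_zero]

theorem isIsomorphic_bidirected_top_iff {r : ℕ} :
    (G.induce (S : Set V)).IsIsomorphic (bidirected (⊤ : SimpleGraph (Fin r))) ↔
      S.card = r ∧ ∀ u ∈ S, ∀ v ∈ S, G.Adj u v ↔ u ≠ v := by
  constructor
  · rintro ⟨e⟩
    refine ⟨by simpa using Fintype.card_congr (e.toEquiv : S ≃ Fin r), fun u hu v hv => ?_⟩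
    have h : (e ⟨u, hu⟩ ≠ e ⟨v, hv⟩) ↔ G.Adj u v := e.map_rel_iff
    rw [← h, e.injective.ne_iff, ne_eq, Subtype.mk.injEq]
  · rintro ⟨hcard, hadj⟩
    have e : (S : Set V) ≃ Fin r := S.equivFinOfCardEq hcard
    refine ⟨⟨e, fun {u v} => ?_⟩⟩
    change e u ≠ e v ↔ G.Adj u v
    rw [hadj u u.2 v v.2, e.injective.ne_iff, ne_eq, Subtype.ext_iff]

theorem coreEnergy_of_complete {k : ℕ} (hcard : S.card = k + 1)
    (hadj : ∀ u ∈ S, ∀ v ∈ S, G.Adj u v ↔ u ≠ v) : G.coreEnergy S = (k + 1) ^ 2 * k := by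
  classical
  have h1 : ∀ u ∈ S, (S.filter fun v => u ≠ v).card = k := fun u hu => by
    rw [Finset.filter_ne, Finset.card_erase_of_mem hu, hcard, Nat.add_sub_cancel]
  have hout : ∀ u ∈ S, G.outdegreeIn S u ^ 2 = k ^ 2 := fun u hu => by
    rw [← h1 u hu, outdegreeIn, Finset.filter_congr fun v hv => hadj u hu v hv]
  have hdigon : ∀ u ∈ S, (S.filter fun v => G.Adj u v ∧ G.Adj v u).card = k := fun u hu => by
    rw [← h1 u hu]
    refine congrArg Finset.card (Finset.filter_congr fun v hv => ?_)
    rw [hadj u hu v hv, hadj v hv u hu]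
    exact ⟨fun h => h.1, fun h => ⟨h, h.symm⟩⟩
  rw [coreEnergy, digonCount, Finset.sum_congr rfl hout, Finset.sum_congr rfl hdigon,
    Finset.sum_const, Finset.sum_const, hcard, smul_eq_mul, smul_eq_mul]
  ring

theorem adj_iff_ne_of_le_outdegreeIn (hG : ∀ v, ¬ G.Adj v v) {k : ℕ} (hcard : S.card = k + 1)
    (hout : ∀ v ∈ S, k ≤ G.outdegreeIn S v) : ∀ u ∈ S, ∀ v ∈ S, G.Adj u v ↔ u ≠ v := by
  classical
  refine fun u hu v hv => ⟨by rintro h rfl; exact hG u h, fun hne => ?_⟩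
  have hsub : S.filter (fun w => G.Adj u w) ⊆ S.erase u := fun w hw => by
    rw [Finset.mem_filter] at hw
    exact Finset.mem_erase.mpr ⟨by rintro rfl; exact hG w hw.2, hw.1⟩
  have heq := Finset.eq_of_subset_of_card_le hsub (by
    rw [Finset.card_erase_of_mem hu, hcard]; exact hout u hu)
  have hmem : v ∈ S.filter fun w => G.Adj u w := heq ▸ Finset.mem_erase.mpr ⟨hne.symm, hv⟩
  exact (Finset.mem_filter.mp hmem).2

end Digraph

/-! ### Digraphs attaining the bounds. -/

namespace Digraph
variable {V : Type*}

theorem connected_of_forall_adj {G : Digraph V} (v₀ : V)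
    (h : ∀ v, v ≠ v₀ → G.Adj v v₀ ∨ G.Adj v₀ v) : G.toSimpleGraphInclusive.Connected := by
  refine SimpleGraph.connected_iff_exists_forall_reachable _ |>.mpr ⟨v₀, fun v => ?_⟩
  by_cases hv : v = v₀
  · rw [hv]
  · exact (SimpleGraph.Adj.reachable (toSimpleGraphInclusive_adj.mpr ⟨hv, h v hv⟩)).symm

/-- The bidirected complete digraph on the first `r` vertices, with an arc from every other vertex
to the first one. -/
def completeWithPendants {n : ℕ} (e : V ≃ Fin n) (r : ℕ) : Digraph V where
  Adj u v := u ≠ v ∧ ((e u).val < r ∧ (e v).val < r ∨ r ≤ (e u).val ∧ (e v).val = 0)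

/-- The directed triangle on the first three vertices, with an arc from every other vertex to the
first one. -/
def triangleWithPendants {n : ℕ} (e : V ≃ Fin n) : Digraph V where
  Adj u v := (e u).val ≤ 1 ∧ (e v).val = (e u).val + 1 ∨ 2 ≤ (e u).val ∧ (e v).val = 0

section
variable {n : ℕ} (e : V ≃ Fin n)

theorem eq_of_val_eq {e : V ≃ Fin n} {u v : V} (h : (e u).val = (e v).val) : u = v :=
  e.injective (Fin.ext h)

theorem completeWithPendants_mem {r : ℕ} (hr : 0 < r) (hrn : r ≤ n) :
    completeWithPendants e r ∈ withDichromaticNumber V r := by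
  have hn : 0 < n := hr.trans_le hrn
  refine ⟨fun v h => h.1 rfl, ?_, dichromaticNumber_eq ?_ ?_⟩
  · refine connected_of_forall_adj (e.symm ⟨0, hn⟩) fun v hv => Or.inl ⟨hv, ?_⟩
    have h0 : (e (e.symm ⟨0, hn⟩)).val = 0 := by simp
    omega
  · refine ⟨fun v => if h : (e v).val < r then ⟨e v, h⟩ else ⟨0, hr⟩, fun i => ?_⟩
    refine isAcyclicOn_of_rank (fun v => if (e v).val < r then 1 else 0) ?_
    rintro u ⟨-, hu⟩ v ⟨-, hv⟩ ⟨hne, ⟨h1, h2⟩ | ⟨h1, h2⟩⟩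
    · dsimp only at hu hv
      rw [dif_pos h1] at hu
      rw [dif_pos h2, ← hu, Fin.mk.injEq] at hv
      exact absurd (eq_of_val_eq hv.symm) hne
    · rw [if_neg (not_lt.mpr h1), if_pos (by omega)]
      exact one_pos
  · rintro k hk ⟨f, hf⟩
    -- With fewer than `r` colours, two of the first `r` vertices share a colour and form a
    -- monochromatic digon.
    obtain ⟨i, j, hij, h⟩ := Fintype.exists_ne_map_eq_of_card_lt
      (fun i : Fin r => f (e.symm (Fin.castLE hrn i))) (by simpa using hk)
    have hne : e.symm (Fin.castLE hrn i) ≠ e.symm (Fin.castLE hrn j) := fun h' =>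
      hij (Fin.castLE_injective hrn (e.symm.injective h'))
    refine (hf (f (e.symm (Fin.castLE hrn i)))).not_digon ⟨trivial, rfl⟩ ⟨trivial, h.symm⟩ hne
      ⟨hne, Or.inl ?_⟩ ⟨hne.symm, Or.inl ?_⟩ <;> simp

theorem coreEnergy_completeWithPendants [Fintype V] {k : ℕ} (hkn : k + 1 ≤ n) :
    (completeWithPendants e (k + 1)).coreEnergy Finset.univ + (k + 1) = (k + 1) ^ 2 * k + n := by
  classical
  have hn : 0 < n := by omega
  set S : Finset V := Finset.univ.filter fun v => (e v).val < k + 1 with hS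
  have hmem : ∀ v, v ∈ S ↔ (e v).val < k + 1 := by simp [hS]
  have hcard : S.card = k + 1 := by
    rw [hS, ← Fintype.card_subtype, Fintype.card_congr
      (e.subtypeEquiv (q := fun i : Fin n => i.val < k + 1) fun _ => Iff.rfl), Fintype.card_subtype,
      Fin.card_filter_val_lt, min_eq_right hkn]
  have hcomp : (completeWithPendants e (k + 1)).HasFunctionalComplement S := by
    refine ⟨fun u hu v hv h => ?_, fun v hv => ?_, fun v hv w h h' => ?_⟩
    · rw [Finset.mem_coe, hmem] at hu hv
      have := h.2
      omega
    · rw [Finset.mem_coe, hmem] at hv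
      refine outdegree_eq_one_iff.mpr ⟨e.symm ⟨0, hn⟩, ⟨?_, ?_⟩, fun w hw => ?_⟩
      · rintro rfl
        simp at hv
      · have h0 : (e (e.symm ⟨0, hn⟩)).val = 0 := by simp
        omega
      · refine eq_of_val_eq (e := e) ?_
        have := hw.2
        simp only [Equiv.apply_symm_apply]
        omega
    · rw [Finset.mem_coe, hmem] at hv
      have h1 := h.2
      have h2 := h'.2
      omega
  have hV : Fintype.card V = n := by simpa using Fintype.card_congr e
  rw [hcomp.coreEnergy_univ, coreEnergy_of_complete hcard, Finset.card_compl, hcard, hV]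
  · omega
  · intro u hu v hv
    rw [hmem] at hu hv
    exact ⟨fun h => h.1, fun h => ⟨h, Or.inl ⟨hu, hv⟩⟩⟩

theorem triangleWithPendants_mem (hn : 3 ≤ n) :
    triangleWithPendants e ∈ withDichromaticNumber V 2 := by
  refine ⟨fun v h => ?_, ?_, dichromaticNumber_eq ?_ ?_⟩
  · simp only [triangleWithPendants] at h
    omega
  · refine connected_of_forall_adj (e.symm ⟨0, by omega⟩) fun v hv => ?_
    have : (e v).val ≠ 0 := fun h => hv (eq_of_val_eq (e := e) (by simpa using h))
    have h0 : (e (e.symm ⟨0, by omega⟩)).val = 0 := by simp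
    simp only [triangleWithPendants]
    omega
  · refine ⟨fun v => if (e v).val = 0 then 0 else 1, fun i => ?_⟩
    refine isAcyclicOn_of_rank (fun v => (e v).val) ?_
    rintro u ⟨-, hu⟩ v ⟨-, hv⟩ huv
    simp only [triangleWithPendants] at huv
    rcases huv with h | h
    · omega
    · dsimp only at hu hv
      rw [if_pos h.2] at hv
      rw [← hv, if_neg (by omega)] at hu
      exact absurd hu (by decide)
  · rintro k hk ⟨f, hf⟩
    have hsub : Subsingleton (Fin k) := Fin.subsingleton_iff_le_one.mpr (by omega)
    let c : Fin 3 → V := fun i => e.symm (Fin.castLE hn i)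
    refine hf (f (c 0)) 3 c (by norm_num) (e.symm.injective.comp (Fin.castLE_injective hn))
      (fun i => ⟨trivial, Subsingleton.elim _ _⟩) fun i => ?_
    simp only [triangleWithPendants, c, Equiv.apply_symm_apply, Fin.val_castLE]
    revert i
    decide

theorem coreEnergy_triangleWithPendants [Fintype V] (hn : 3 ≤ n) :
    (triangleWithPendants e).coreEnergy Finset.univ = n := by
  classical
  -- The empty core suffices: every vertex has outdegree 1 and there is no digon, so each vertex
  -- contributes 1.
  have hcomp : (triangleWithPendants e).HasFunctionalComplement ((∅ : Finset V) : Set V) := by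
    refine ⟨by simp, fun v _ => outdegree_eq_one_iff.mpr ?_, fun v _ w h h' => ?_⟩
    · have hex : ∃ m : Fin n, ∀ w, (triangleWithPendants e).Adj v w ↔ (e w).val = m.val := by
        by_cases hv : (e v).val ≤ 1
        · refine ⟨⟨(e v).val + 1, by omega⟩, fun w => ?_⟩
          simp only [triangleWithPendants]; omega
        · refine ⟨⟨0, by omega⟩, fun w => ?_⟩
          simp only [triangleWithPendants]; omega
      obtain ⟨m, hm⟩ := hex
      refine ⟨e.symm m, (hm _).mpr (by simp), fun w hw => eq_of_val_eq (e := e) ?_⟩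
      simpa using (hm w).mp hw
    · simp only [triangleWithPendants] at h h'
      omega
  rw [hcomp.coreEnergy_univ]
  simpa [coreEnergy, digonCount] using Fintype.card_congr e

end

end Digraph

/-! ### The bounds with their equality cases. -/

namespace Digraph
variable {V : Type*} [Fintype V] {G : Digraph V}

theorem card_le_coreEnergy_of_mem (hG : G ∈ withDichromaticNumber V 2) :
    Fintype.card V ≤ G.coreEnergy Finset.univ ∧
      (G.coreEnergy Finset.univ = Fintype.card V ↔
        ∃ (l : ℕ) (S : Set V), 3 ≤ l ∧ (G.induce S).IsIsomorphic (directedCycle l) ∧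
          G.HasHangingInTrees S) := by
  classical
  obtain ⟨hloop, hconn, hdi⟩ := hG
  obtain ⟨S, hS⟩ := exists_minimal_not_colorableOn
    (not_colorableOn_of_lt_dichromaticNumber (G := G) (k := 1) (by omega))
  have hne := nonempty_of_not_colorableOn one_pos hS.1
  have hout : ∀ v ∈ S, 1 ≤ G.outdegreeIn S v := fun v hv => le_outdegreeIn_of_minimal hloop hS hv
  obtain ⟨hle, heq⟩ := coreEnergy_add_card_compl_le hconn hne hout
  have hout2 : ∀ v ∈ S, 1 ≤ G.outdegreeIn S v ^ 2 := fun v hv => Nat.one_le_pow _ _ (hout v hv)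
  have hsum := Finset.sum_le_sum hout2
  rw [Finset.sum_const, smul_eq_mul, mul_one] at hsum
  have hcore : G.coreEnergy S = ∑ v ∈ S, G.outdegreeIn S v ^ 2 + G.digonCount S := rfl
  have hcard := Finset.card_add_card_compl S
  refine ⟨by omega, fun h => ?_, ?_⟩
  · have hone : ∑ v ∈ S, 1 = ∑ v ∈ S, G.outdegreeIn S v ^ 2 := by
      rw [Finset.sum_const, smul_eq_mul, mul_one]; omega
    obtain ⟨l, hl, hiso⟩ := exists_isIsomorphic_directedCycle_of_minimal hloop hS
      (fun v hv => by
        simpa using ((Finset.sum_eq_sum_iff_of_le hout2).mp hone v hv).symm)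
      (digonCount_eq_zero_iff.mp (by omega))
    exact ⟨l, S, hl, hiso, (heq (by omega)).hasHangingInTrees hconn hne⟩
  · rintro ⟨l, T, hl, hiso, hT⟩
    obtain ⟨T, rfl⟩ := T.toFinite.exists_finset_coe
    rw [hT.hasFunctionalComplement.coreEnergy_univ,
      coreEnergy_of_isIsomorphic_directedCycle hl hiso, Finset.card_add_card_compl]

theorem le_coreEnergy_of_mem {k : ℕ} (hk : 2 ≤ k) (hG : G ∈ withDichromaticNumber V (k + 1)) :
    (k + 1) ^ 2 * k + Fintype.card V ≤ G.coreEnergy Finset.univ + (k + 1) ∧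
      (G.coreEnergy Finset.univ + (k + 1) = (k + 1) ^ 2 * k + Fintype.card V ↔
        ∃ S : Set V, (G.induce S).IsIsomorphic (bidirected (⊤ : SimpleGraph (Fin (k + 1)))) ∧
          G.HasHangingInTrees S) := by
  classical
  obtain ⟨hloop, hconn, hdi⟩ := hG
  obtain ⟨S, hS⟩ := exists_minimal_not_colorableOn
    (not_colorableOn_of_lt_dichromaticNumber (G := G) (k := k) (by omega))
  have hne := nonempty_of_not_colorableOn (by omega) hS.1
  have hout : ∀ v ∈ S, k ≤ G.outdegreeIn S v := fun v hv => le_outdegreeIn_of_minimal hloop hS hv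
  obtain ⟨hle, heq⟩ := coreEnergy_add_card_compl_le hconn hne
    fun v hv => (by omega : 1 ≤ k).trans (hout v hv)
  obtain ⟨hle', heq'⟩ := coreEnergy_lower_bound hloop hk hS.1 hout
  have hcard := Finset.card_add_card_compl S
  refine ⟨by omega, fun h => ?_, ?_⟩
  · have hScard := heq' (by omega)
    exact ⟨S, isIsomorphic_bidirected_top_iff.mpr
      ⟨hScard, adj_iff_ne_of_le_outdegreeIn hloop hScard hout⟩,
      (heq (by omega)).hasHangingInTrees hconn hne⟩
  · rintro ⟨T, hiso, hT⟩
    obtain ⟨T, rfl⟩ := T.toFinite.exists_finset_coe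
    obtain ⟨hTcard, hadj⟩ := isIsomorphic_bidirected_top_iff.mp hiso
    have := Finset.card_add_card_compl T
    rw [hT.hasFunctionalComplement.coreEnergy_univ, coreEnergy_of_complete hTcard hadj]
    omega

theorem coreEnergy_eq_four_of_card_eq_two (hV : Fintype.card V = 2)
    (hG : G ∈ withDichromaticNumber V 2) :
    G.coreEnergy Finset.univ = 4 ∧ G.IsIsomorphic (directedCycle 2) := by
  obtain ⟨hloop, -, hdi⟩ := hG
  obtain ⟨S, hS⟩ := exists_minimal_not_colorableOn
    (not_colorableOn_of_lt_dichromaticNumber (G := G) (k := 1) (by omega))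
  have hout : ∀ v ∈ S, 1 ≤ G.outdegreeIn S v := fun v hv => le_outdegreeIn_of_minimal hloop hS hv
  obtain ⟨v, hv⟩ := nonempty_of_not_colorableOn one_pos hS.1
  have hlt := (hout v hv).trans_lt (outdegreeIn_lt_card hloop hv)
  -- A vertex of `S` has an out-neighbour in `S` other than itself, so `S` contains both vertices.
  obtain rfl : S = Finset.univ :=
    Finset.eq_univ_of_card S (le_antisymm (Finset.card_le_univ S) (by omega))
  have hadj := adj_iff_ne_of_le_outdegreeIn (k := 1) hloop (by rw [Finset.card_univ, hV]) hout
  refine ⟨by rw [coreEnergy_of_complete (k := 1) (by rw [Finset.card_univ, hV]) hadj]; norm_num, ?_⟩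
  let e : V ≃ Fin 2 := Fintype.equivFinOfCardEq hV
  refine ⟨⟨e, fun {u v} => ?_⟩⟩
  have h2 : ∀ i j : Fin 2, finRotate 2 i = j ↔ i ≠ j := by decide
  change finRotate 2 (e u) = e v ↔ G.Adj u v
  rw [h2, hadj u (Finset.mem_univ u) v (Finset.mem_univ v), e.injective.ne_iff]

end Digraph

theorem theorem2p10 {V : Type*} [Fintype V] [DecidableEq V] (n : ℕ) (hn : Fintype.card V = n) :
    -- dichromatic number 2, order 2
    (n = 2 →
      (∃ G ∈ Digraph.withDichromaticNumber V 2, G.laplacianEnergy = 4) ∧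
      ∀ G ∈ Digraph.withDichromaticNumber V 2,
        4 ≤ G.laplacianEnergy ∧
        (G.laplacianEnergy = 4 ↔ G.IsIsomorphic (Digraph.directedCycle 2))) ∧
    -- dichromatic number 2, order at least 3
    (3 ≤ n →
      (∃ G ∈ Digraph.withDichromaticNumber V 2, G.laplacianEnergy = n) ∧
      ∀ G ∈ Digraph.withDichromaticNumber V 2,
        (n : ℂ) ≤ G.laplacianEnergy ∧
        (G.laplacianEnergy = n ↔
          ∃ (l : ℕ) (S : Set V), 3 ≤ l ∧ (G.induce S).IsIsomorphic (Digraph.directedCycle l) ∧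
            G.HasHangingInTrees S)) ∧
    -- dichromatic number at least 3
    (∀ r : ℕ, 3 ≤ r →
      (r ≤ n → ∃ G ∈ Digraph.withDichromaticNumber V r,
        G.laplacianEnergy = (n : ℂ) + (r : ℂ) ^ 3 - (r : ℂ) ^ 2 - (r : ℂ)) ∧
      ∀ G ∈ Digraph.withDichromaticNumber V r,
        (n : ℂ) + (r : ℂ) ^ 3 - (r : ℂ) ^ 2 - (r : ℂ) ≤ G.laplacianEnergy ∧
        (G.laplacianEnergy = (n : ℂ) + (r : ℂ) ^ 3 - (r : ℂ) ^ 2 - (r : ℂ) ↔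
          ∃ S : Set V, (G.induce S).IsIsomorphic (Digraph.bidirected (⊤ : SimpleGraph (Fin r))) ∧
            G.HasHangingInTrees S)) := by
  let e : V ≃ Fin n := Fintype.equivFinOfCardEq hn
  refine ⟨?_, fun h3 => ⟨?_, fun G hG => ?_⟩, fun r hr => ?_⟩
  · intro h2
    have hall : ∀ G ∈ Digraph.withDichromaticNumber V 2, G.laplacianEnergy = 4 := fun G hG => by
      rw [Digraph.laplacianEnergy_eq_coreEnergy hG.1,
        (Digraph.coreEnergy_eq_four_of_card_eq_two (hn.trans h2) hG).1]
      norm_num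
    refine ⟨⟨_, Digraph.completeWithPendants_mem e two_pos h2.ge,
      hall _ (Digraph.completeWithPendants_mem e two_pos h2.ge)⟩, fun G hG => ⟨(hall G hG).ge, ?_⟩⟩
    exact iff_of_true (hall G hG) (Digraph.coreEnergy_eq_four_of_card_eq_two (hn.trans h2) hG).2
  · have hmem := Digraph.triangleWithPendants_mem e h3
    exact ⟨_, hmem, by
      rw [Digraph.laplacianEnergy_eq_coreEnergy hmem.1, Digraph.coreEnergy_triangleWithPendants e h3]⟩
  · obtain ⟨hle, hiff⟩ := Digraph.card_le_coreEnergy_of_mem hG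
    rw [hn] at hle hiff
    rw [Digraph.laplacianEnergy_eq_coreEnergy hG.1, Nat.cast_inj]
    exact ⟨by exact_mod_cast hle, hiff⟩
  · obtain ⟨k, rfl⟩ : ∃ k, r = k + 1 := ⟨r - 1, by omega⟩
    have hval : (n : ℂ) + ((k + 1 : ℕ) : ℂ) ^ 3 - ((k + 1 : ℕ) : ℂ) ^ 2 - ((k + 1 : ℕ) : ℂ) =
        (((k + 1) ^ 2 * k + n : ℕ) : ℂ) - ((k + 1 : ℕ) : ℂ) := by
      push_cast; ring
    rw [hval]
    refine ⟨fun hrn => ?_, fun G hG => ?_⟩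
    · have hmem := Digraph.completeWithPendants_mem e k.succ_pos hrn
      refine ⟨_, hmem, ?_⟩
      rw [Digraph.laplacianEnergy_eq_coreEnergy hmem.1, eq_sub_iff_add_eq, ← Nat.cast_add, Nat.cast_inj]
      exact Digraph.coreEnergy_completeWithPendants e hrn
    · obtain ⟨hle, hiff⟩ := Digraph.le_coreEnergy_of_mem (by omega) hG
      rw [hn] at hle hiff
      rw [Digraph.laplacianEnergy_eq_coreEnergy hG.1, sub_le_iff_le_add, eq_sub_iff_add_eq,
        ← Nat.cast_add, Nat.cast_inj]
      exact ⟨by exact_mod_cast hle, hiff⟩
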